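/- Let $A\in\mathbb R^{n\times n}$, $B\in\mathbb R^{n\times m}$, $\Xi\in\mathbb R^{n\times k}$, let $Q,Q_f\in\mathbb R^{n\times n}$ be symmetric positive semidefinite, $R\in\mathbb R^{m\times m}$ symmetric positive definite and $\lambda>0$. Consider $x_{t+1}=Ax_t+Bu_t+\Xi w_t$. At every stage the empirical distribution of the disturbance is $\nu=\frac1N\sum_{i=1}^N\delta_{\hat w^{(i)}}$ with $N\ge 1$ fixed samples $\hat w^{(i)}\in\mathbb R^k$; let $\bar w=\frac1N\sum_i\hat w^{(i)}$ be its mean. Put $\Phi=BR^{-1}B^\top-\frac1\lambda\Xi\Xi^\top$ and, for each horizon $T$, $P_T=Q_f$, $P_t=Q+A^\top(I+P_{t+1}\Phi)^{-1}P_{t+1}A$ for $t<T$. Assume: 1. for every horizon $T$ and every $1\le t\le T$, $\lambda$ is larger than the largest eigenvalue of $\Xi^\top P_t\,\Xi$; 2. $\nu$ is the same at all stages (as above); 3. $\Phi\succeq0$ and $(A,\Phi^{1/2})$ is stabilizable; 4. $(A,Q^{1/2})$ is observable; and assume that $\bar w=0$. Then $P_{ss}=\lim_{T\to\infty}P_t$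 exists and is a symmetric positive semidefinite solution of $P=Q+A^\top(I+P\Phi)^{-1}PA$. Let $\pi^\star_{ss}(x)=K_{ss}x+L_{ss}$ be the stationary minimax controller, where $$K_{ss}=-R^{-1}B^\top(I+P_{ss}\Phi)^{-1}P_{ss}A,\qquad L_{ss}=-R^{-1}B^\top(I+P_{ss}\Phi)^{-1}(P_{ss}\Xi\bar w+r_{ss}),$$ $$r_{ss}=[I-A^\top(I+P_{ss}\Phi)^{-1}]^{-1}A^\top(I+P_{ss}\Phi)^{-1}P_{ss}\Xi\bar w .$$ (a) $\pi^\star_{ss}$ is the stationary $H_\infty$ game controller. That is, for each horizon $T$ consider the deterministic game with cost $\sum_{t=0}^{T-1}(x_t^\top Qx_t+u_t^\top Ru_t-\lambda\|w_t\|^2)+x_T^\top Q_fx_T$, in which $u_t=\pi_t(x_t)$ with $\pi_t$ measurable, and the opponent chooses the vector $w_t=\tilde\gamma_t(x_t)$. Policies $\pi$ that attain $\inf_\pi\sup_{\tilde\gamma}$ of the cost-to-go from every stage $t<T$ and every state exist, and, for any choice of such a policy $\pi^{(T)}$ for each $T$, $\pi^{(T)}_t(x)\to\pi^\star_{ss}(x)$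 as $T\to\infty$ for all $t$ and $x$. (b) $A+BK_{ss}$ is stable (all its eigenvalues lie in the open unit disc). With zero initial state $x_0=0$, the closed loop under $\pi^\star_{ss}$ from the disturbance $w$ to the error output $z_t=(Q^{1/2}x_t,R^{1/2}u_t)$ has, on $|\zeta|\ge1$, the transfer function $$T_{\pi^\star_{ss}}(\zeta)=\begin{bmatrix}Q^{1/2}\\R^{1/2}K_{ss}\end{bmatrix}(\zeta I-A-BK_{ss})^{-1}\Xi ,$$ and $$\|T_{\pi^\star_{ss}}\|_\infty:=\sup_{\theta\in\mathbb R}\bar\sigma\big(T_{\pi^\star_{ss}}(e^{i\theta})\big)\le\sqrt\lambda,$$ where $\bar\sigma$ denotes the largest singular value. -/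

import Mathlib

open Filter Topology Matrix
open scoped MatrixOrder Matrix.Norms.L2Operator ENNReal

noncomputable section

/-- Data of the problem: the system `x_{t+1} = A x_t + B u_t + Ξ w_t`, the weights `Q`, `Qf`, `R`,
the penalty parameter `lam`, and the sample `what 0, …, what (N-1)` that defines the empirical
distribution `(1/N) ∑ δ_{what i}`, the same at every stage. -/
structure MinimaxLQ (n m k N : ℕ) where
  A : Matrix (Fin n) (Fin n) ℝ
  B : Matrix (Fin n) (Fin m) ℝ
  Xi : Matrix (Fin n) (Fin k) ℝ
  Q : Matrix (Fin n) (Fin n) ℝ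
  Qf : Matrix (Fin n) (Fin n) ℝ
  R : Matrix (Fin m) (Fin m) ℝ
  lam : ℝ
  what : Fin N → Fin k → ℝ

/-- A real square matrix is stable: its complex eigenvalues lie in the open unit disc. -/
def IsStableMatrix {n : ℕ} (M : Matrix (Fin n) (Fin n) ℝ) : Prop :=
  ∀ μ ∈ spectrum ℂ (M.map (algebraMap ℝ ℂ)), ‖μ‖ < 1

/-- `(A, B)` is stabilizable: some state feedback makes `A + B F` stable. -/
def IsStabilizable {n p : ℕ} (A : Matrix (Fin n) (Fin n) ℝ) (B : Matrix (Fin n) (Fin p) ℝ) :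
    Prop :=
  ∃ F : Matrix (Fin p) (Fin n) ℝ, IsStableMatrix (A + B * F)

/-- `(A, C)` is observable: the observability matrix with blocks `C A^i`, `i < n`, has trivial
kernel. -/
def IsObservable {n p : ℕ} (A : Matrix (Fin n) (Fin n) ℝ) (C : Matrix (Fin p) (Fin n) ℝ) : Prop :=
  ∀ x : Fin n → ℝ, (∀ i < n, (C * A ^ i) *ᵥ x = 0) → x = 0

namespace MinimaxLQ

variable {n m k N : ℕ} (S : MinimaxLQ n m k N)

/-- Standing conventions: `N ≥ 1`, `Q, Qf` symmetric PSD, `R` symmetric positive definite,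
`lam > 0`. -/
def Standing : Prop :=
  0 < N ∧ S.Q.PosSemidef ∧ S.Qf.PosSemidef ∧ S.R.PosDef ∧ 0 < S.lam

/-- The mean of the empirical distribution. -/
def wbar : Fin k → ℝ := (N : ℝ)⁻¹ • ∑ i, S.what i

/-- `Φ = B R⁻¹ Bᵀ - (1/lam) Ξ Ξᵀ`. -/
def Phi : Matrix (Fin n) (Fin n) ℝ :=
  S.B * S.R⁻¹ * S.Bᵀ - S.lam⁻¹ • (S.Xi * S.Xiᵀ)

/-- The map `P ↦ Q + Aᵀ (I + P Φ)⁻¹ P A`. -/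
def riccatiMap (P : Matrix (Fin n) (Fin n) ℝ) : Matrix (Fin n) (Fin n) ℝ :=
  S.Q + S.Aᵀ * (1 + P * S.Phi)⁻¹ * P * S.A

/-- The Riccati recursion in time to go: `riccati s` is the matrix `P_{T-s}` of the problem with
horizon `T ≥ s` and terminal condition `P_T = Qf`. -/
def riccati : ℕ → Matrix (Fin n) (Fin n) ℝ
  | 0 => S.Qf
  | s + 1 => S.riccatiMap (riccati s)

/-- The penalty parameter exceeds the largest eigenvalue of `Ξᵀ P_t Ξ` for every `t ≥ 1` and every
horizon `T ≥ t`. -/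
def PenaltyCondition : Prop :=
  ∀ s : ℕ, ∀ μ ∈ spectrum ℝ (S.Xiᵀ * S.riccati s * S.Xi), μ < S.lam

/-- `Φ ⪰ 0` and `(A, Φ^{1/2})` is stabilizable. -/
def StabilizabilityCondition : Prop :=
  S.Phi.PosSemidef ∧ IsStabilizable S.A (CFC.sqrt S.Phi)

/-- `(A, Q^{1/2})` is observable. -/
def ObservabilityCondition : Prop :=
  IsObservable S.A (CFC.sqrt S.Q)

/-! ### The stationary minimax controller -/

/-- `K = -R⁻¹ Bᵀ (I + P Φ)⁻¹ P A`. -/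
def gainK (P : Matrix (Fin n) (Fin n) ℝ) : Matrix (Fin m) (Fin n) ℝ :=
  -(S.R⁻¹ * S.Bᵀ * (1 + P * S.Phi)⁻¹ * P * S.A)

/-- `r = [I - Aᵀ (I + P Φ)⁻¹]⁻¹ Aᵀ (I + P Φ)⁻¹ P Ξ w̄`. -/
def rVec (P : Matrix (Fin n) (Fin n) ℝ) : Fin n → ℝ :=
  ((1 - S.Aᵀ * (1 + P * S.Phi)⁻¹)⁻¹ * S.Aᵀ * (1 + P * S.Phi)⁻¹ * P * S.Xi) *ᵥ S.wbar

/-- `L = -R⁻¹ Bᵀ (I + P Φ)⁻¹ (P Ξ w̄ + r)`. -/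
def offsetL (P : Matrix (Fin n) (Fin n) ℝ) : Fin m → ℝ :=
  -((S.R⁻¹ * S.Bᵀ * (1 + P * S.Phi)⁻¹) *ᵥ ((P * S.Xi) *ᵥ S.wbar + S.rVec P))

/-- The policy `x ↦ K x + L` built from the matrix `P`. -/
def minimaxPolicy (P : Matrix (Fin n) (Fin n) ℝ) (x : Fin n → ℝ) : Fin m → ℝ :=
  S.gainK P *ᵥ x + S.offsetL P

/-! ### The `H∞` dynamic game -/

/-- The state `s` steps after stage `t`, where the state is `x`, when the controller uses the Markov
policy `π` and the opponent picks the disturbance vector by the Markov policy `γ`. -/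
def gameState (π : ℕ → (Fin n → ℝ) → (Fin m → ℝ)) (γ : ℕ → (Fin n → ℝ) → (Fin k → ℝ))
    (t : ℕ) (x : Fin n → ℝ) : ℕ → (Fin n → ℝ)
  | 0 => x
  | s + 1 =>
    S.A *ᵥ gameState π γ t x s + S.B *ᵥ π (t + s) (gameState π γ t x s)
      + S.Xi *ᵥ γ (t + s) (gameState π γ t x s)

/-- The running cost `xᵀ Q x + uᵀ R u - lam ‖w‖²`. -/
def stageCost (x : Fin n → ℝ) (u : Fin m → ℝ) (w : Fin k → ℝ) : ℝ :=
  x ⬝ᵥ (S.Q *ᵥ x) + u ⬝ᵥ (S.R *ᵥ u) - S.lam * (w ⬝ᵥ w)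

/-- The cost from stage `t` and state `x` on, in the game with horizon `T` (for `t ≤ T`). -/
def gameCost (T t : ℕ) (x : Fin n → ℝ) (π : ℕ → (Fin n → ℝ) → (Fin m → ℝ))
    (γ : ℕ → (Fin n → ℝ) → (Fin k → ℝ)) : ℝ :=
  ∑ s ∈ Finset.range (T - t),
      S.stageCost (S.gameState π γ t x s) (π (t + s) (S.gameState π γ t x s))
        (γ (t + s) (S.gameState π γ t x s))
    + S.gameState π γ t x (T - t) ⬝ᵥ (S.Qf *ᵥ S.gameState π γ t x (T - t))

/-- `π` is a minimax policy of the game with horizon `T`: it is measurable and, from every stage and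
state (in particular from `x_0 = 0` at stage `0`), attains `inf_π sup_γ` of the cost. -/
def IsHInfPolicy (T : ℕ) (π : ℕ → (Fin n → ℝ) → (Fin m → ℝ)) : Prop :=
  (∀ t, Measurable (π t)) ∧
    ∀ t < T, ∀ x : Fin n → ℝ, ∀ π' : ℕ → (Fin n → ℝ) → (Fin m → ℝ), (∀ s, Measurable (π' s)) →
      (⨆ γ : ℕ → (Fin n → ℝ) → (Fin k → ℝ), (S.gameCost T t x π γ : EReal)) ≤
        ⨆ γ : ℕ → (Fin n → ℝ) → (Fin k → ℝ), (S.gameCost T t x π' γ : EReal)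

/-- `κ` is the stationary `H∞` game controller: minimax policies exist for every horizon `T`, and,
whichever are taken, their value at each stage and state converges to `κ` as `T → ∞`. -/
def IsHInfController (κ : (Fin n → ℝ) → (Fin m → ℝ)) : Prop :=
  (∀ T, ∃ π, S.IsHInfPolicy T π) ∧
    ∀ π : ℕ → ℕ → (Fin n → ℝ) → (Fin m → ℝ), (∀ T, S.IsHInfPolicy T (π T)) →
      ∀ (t : ℕ) (x : Fin n → ℝ), Tendsto (fun T => π T t x) atTop (𝓝 (κ x))

/-! ### The closed loop from disturbance to error output -/

/-- The closed-loop state under the stationary policy `κ` and the disturbance sequence `w`, with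
initial state `x_0 = 0`. -/
def closedLoopState (κ : (Fin n → ℝ) → (Fin m → ℝ)) (w : ℕ → Fin k → ℝ) : ℕ → (Fin n → ℝ)
  | 0 => 0
  | t + 1 =>
    S.A *ᵥ closedLoopState κ w t + S.B *ᵥ κ (closedLoopState κ w t) + S.Xi *ᵥ w t

/-- The error output `z_t = (Q^{1/2} x_t, R^{1/2} u_t)` of that closed loop. -/
def errorOutput (κ : (Fin n → ℝ) → (Fin m → ℝ)) (w : ℕ → Fin k → ℝ) (t : ℕ) :
    Fin n ⊕ Fin m → ℝ :=
  Sum.elim (CFC.sqrt S.Q *ᵥ S.closedLoopState κ w t)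
    (CFC.sqrt S.R *ᵥ κ (S.closedLoopState κ w t))

/-- `G` is the transfer function from `w` to `z` under `κ` with zero initial state, on `1 ≤ |ζ|`:
the `ζ`-transform of the output is `G ζ` times that of the input, for all finitely supported
inputs (these determine `G` there). -/
def IsTransferFunction (κ : (Fin n → ℝ) → (Fin m → ℝ))
    (G : ℂ → Matrix (Fin n ⊕ Fin m) (Fin k) ℂ) : Prop :=
  ∀ (w : ℕ → Fin k → ℝ) (M : ℕ), (∀ t, M ≤ t → w t = 0) → ∀ ζ : ℂ, 1 ≤ ‖ζ‖ →
    HasSum (fun (t : ℕ) (i : Fin n ⊕ Fin m) => (ζ⁻¹) ^ t * (S.errorOutput κ w t i : ℂ))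
      (G ζ *ᵥ ∑ t ∈ Finset.range M, fun j => (ζ⁻¹) ^ t * (w t j : ℂ))

/-- `[Q^{1/2}; R^{1/2} K] (ζ I - (A + B K))⁻¹ Ξ`, for the linear feedback `u = K x`. -/
def transfer (K : Matrix (Fin m) (Fin n) ℝ) (ζ : ℂ) : Matrix (Fin n ⊕ Fin m) (Fin k) ℂ :=
  (Matrix.fromRows (CFC.sqrt S.Q) (CFC.sqrt S.R * K)).map (algebraMap ℝ ℂ)
    * (ζ • (1 : Matrix (Fin n) (Fin n) ℂ) - (S.A + S.B * K).map (algebraMap ℝ ℂ))⁻¹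
    * S.Xi.map (algebraMap ℝ ℂ)

end MinimaxLQ

/-- The largest singular value of a complex matrix, i.e. its operator norm for Euclidean norms. -/
def sigmaMax {p q : Type*} [Fintype p] [Fintype q] [DecidableEq q] (M : Matrix p q ℂ) : ℝ := ‖M‖

/-- The discrete-time `H∞` norm `sup_θ σ̄(G(e^{iθ}))`, as an extended nonnegative real. -/
def hInfNorm {p q : Type*} [Fintype p] [Fintype q] [DecidableEq q] (G : ℂ → Matrix p q ℂ) :
    ℝ≥0∞ :=
  ⨆ θ : ℝ, ENNReal.ofReal (sigmaMax (G (Complex.exp (θ * Complex.I))))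

end

/-! The data enter the Riccati map only through `A`, `Q` and `Φ`. As `Φ ⪰ 0`, it is also the Riccati
map of the undisturbed regulator with input matrix `Φ^{1/2}` and unit input weight (`lqr`), so
`P_ss` comes from classical value iteration: from weight zero the iterates increase and are bounded
by the cost of a stabilizing feedback. The limit is a Lyapunov function for its own closed loop,
stable by observability, and running that loop carries the convergence over to the terminal weight
`Qf`.

The game rests on one completion of the square, `stepCost_saddle`: about the saddle gains the
one-stage cost is the Riccati value plus a quadratic form in the deviations `d`, `v` of the two
players, with no linear term. Setting `v = 0` shows that the controller loses at least `dᵀ R d`;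
setting `d = 0` and using the penalty condition shows that the opponent gains nothing. Summed over
stages, this gives the value of the finite game and the uniqueness of its minimax policy, whose
gains are continuous in the Riccati iterates.

In the limit the penalty condition survives as a non-strict inequality, which makes `xᵀ P_ss x` a
storage function for the supply rate `lam ‖w‖² - ‖z‖²`. With `w = 0` this yields stability; on the
unit circle it yields the `H∞` bound. Since `w̄ = 0`, the controller has no offset. -/

noncomputable section

/-! ### The saddle point of the one-stage game -/

namespace MinimaxLQ

variable {n m k N : ℕ} (S : MinimaxLQ n m k N)

/-- The opponent's gain `lam⁻¹ Ξᵀ (I + P Φ)⁻¹ P A` at the saddle point of one stage. -/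
def gainW (P : Matrix (Fin n) (Fin n) ℝ) : Matrix (Fin k) (Fin n) ℝ :=
  S.lam⁻¹ • (S.Xiᵀ * ((1 + P * S.Phi)⁻¹ * P * S.A))

/-- The next state. -/
def next (x : Fin n → ℝ) (u : Fin m → ℝ) (w : Fin k → ℝ) : Fin n → ℝ :=
  S.A *ᵥ x + S.B *ᵥ u + S.Xi *ᵥ w

/-- The cost of one stage with terminal weight `P`. -/
def stepCost (P : Matrix (Fin n) (Fin n) ℝ) (x : Fin n → ℝ) (u : Fin m → ℝ) (w : Fin k → ℝ) : ℝ :=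
  S.stageCost x u w + S.next x u w ⬝ᵥ (P *ᵥ S.next x u w)

end MinimaxLQ

lemma dotProduct_mulVec_comm_of_isSymm {n : ℕ} {P : Matrix (Fin n) (Fin n) ℝ} (hP : Pᵀ = P)
    (x y : Fin n → ℝ) : x ⬝ᵥ (P *ᵥ y) = y ⬝ᵥ (P *ᵥ x) := by
  rw [dotProduct_mulVec, ← mulVec_transpose, hP, dotProduct_comm]

lemma dotProduct_transpose_mulVec_swap {n m : ℕ} (M : Matrix (Fin n) (Fin m) ℝ) (x : Fin m → ℝ)
    (y : Fin n → ℝ) : x ⬝ᵥ (Mᵀ *ᵥ y) = (M *ᵥ x) ⬝ᵥ y := by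
  rw [dotProduct_mulVec, vecMul_transpose]

lemma Matrix.PosSemidef.transpose_eq_self {n : ℕ} {P : Matrix (Fin n) (Fin n) ℝ}
    (hP : P.PosSemidef) : Pᵀ = P := by
  simpa using hP.isHermitian.eq

lemma Matrix.PosSemidef.quad_nonneg {n : ℕ} {P : Matrix (Fin n) (Fin n) ℝ}
    (hP : P.PosSemidef) (x : Fin n → ℝ) : 0 ≤ x ⬝ᵥ (P *ᵥ x) := by
  simpa using hP.dotProduct_mulVec_nonneg x

lemma posSemidef_of_quad_nonneg {n : ℕ} {P : Matrix (Fin n) (Fin n) ℝ}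
    (hP : Pᵀ = P) (h : ∀ x : Fin n → ℝ, 0 ≤ x ⬝ᵥ (P *ᵥ x)) : P.PosSemidef :=
  Matrix.PosSemidef.of_dotProduct_mulVec_nonneg (by simpa [Matrix.IsHermitian] using hP)
    (fun x => by simpa using h x)

lemma Matrix.PosSemidef.mulVec_eq_zero_of_quad {n : ℕ} {P : Matrix (Fin n) (Fin n) ℝ}
    (hP : P.PosSemidef) {x : Fin n → ℝ} (h : x ⬝ᵥ (P *ᵥ x) = 0) : P *ᵥ x = 0 := by
  simpa using (hP.dotProduct_mulVec_zero_iff x).1 (by simpa using h)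

/-- Pairing `x + P Φ x = 0` with `Φ x` gives two nonnegative terms with sum zero; hence `P Φ x = 0`,
and then `x = 0`. -/
lemma isUnit_one_add_mul_of_posSemidef {n : ℕ} {P Φ : Matrix (Fin n) (Fin n) ℝ}
    (hP : P.PosSemidef) (hΦ : Φ.PosSemidef) : IsUnit (1 + P * Φ) := by
  rw [← Matrix.mulVec_injective_iff_isUnit]
  refine (injective_iff_map_eq_zero (Matrix.mulVecLin (1 + P * Φ))).2 fun x hx => ?_
  have h1 : x + P *ᵥ (Φ *ᵥ x) = 0 := by
    simpa [Matrix.add_mulVec, Matrix.mulVec_mulVec] using hx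
  have h2 : x ⬝ᵥ (Φ *ᵥ x) + (Φ *ᵥ x) ⬝ᵥ (P *ᵥ (Φ *ᵥ x)) = 0 := by
    have := congrArg (fun z => (Φ *ᵥ x) ⬝ᵥ z) h1
    simp only [dotProduct_add, dotProduct_zero] at this
    rwa [dotProduct_comm (Φ *ᵥ x) x] at this
  have h3 : (Φ *ᵥ x) ⬝ᵥ (P *ᵥ (Φ *ᵥ x)) = 0 := by
    have := hΦ.quad_nonneg x
    have := hP.quad_nonneg (Φ *ᵥ x)
    linarith
  rw [hP.mulVec_eq_zero_of_quad h3, add_zero] at h1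
  exact h1

namespace MinimaxLQ

variable {n m k N : ℕ} (S : MinimaxLQ n m k N)

/-- The saddle point dynamics `(I + Φ P)⁻¹ A`. -/
def saddleA (P : Matrix (Fin n) (Fin n) ℝ) : Matrix (Fin n) (Fin n) ℝ :=
  (1 + S.Phi * P)⁻¹ * S.A

section
variable {S} {P : Matrix (Fin n) (Fin n) ℝ} (hP : P.PosSemidef) (hΦ : S.Phi.PosSemidef)
include hP hΦ

lemma inv_mul_eq_mul_saddleA : (1 + P * S.Phi)⁻¹ * P * S.A = P * S.saddleA P := by
  have h1 := (Matrix.isUnit_iff_isUnit_det _).1 (isUnit_one_add_mul_of_posSemidef hP hΦ)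
  have h2 := (Matrix.isUnit_iff_isUnit_det _).1 (isUnit_one_add_mul_of_posSemidef hΦ hP)
  rw [saddleA, ← Matrix.mul_assoc]
  congr 1
  have h : P * (1 + S.Phi * P) = (1 + P * S.Phi) * P := by noncomm_ring
  calc (1 + P * S.Phi)⁻¹ * P
      = (1 + P * S.Phi)⁻¹ * (P * (1 + S.Phi * P)) * (1 + S.Phi * P)⁻¹ := by
        rw [Matrix.mul_assoc, Matrix.mul_assoc, Matrix.mul_nonsing_inv _ h2, Matrix.mul_one]
    _ = P * (1 + S.Phi * P)⁻¹ := by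
        rw [h, ← Matrix.mul_assoc, Matrix.nonsing_inv_mul _ h1, Matrix.one_mul]

lemma saddleA_add : S.saddleA P + S.Phi * P * S.saddleA P = S.A := by
  have h2 := (Matrix.isUnit_iff_isUnit_det _).1 (isUnit_one_add_mul_of_posSemidef hΦ hP)
  calc S.saddleA P + S.Phi * P * S.saddleA P
      = (1 + S.Phi * P) * (1 + S.Phi * P)⁻¹ * S.A := by
        rw [saddleA]; noncomm_ring
    _ = S.A := by rw [Matrix.mul_nonsing_inv _ h2, Matrix.one_mul]

lemma riccatiMap_eq : S.riccatiMap P = S.Q + S.Aᵀ * (P * S.saddleA P) := by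
  rw [riccatiMap, ← inv_mul_eq_mul_saddleA hP hΦ]; simp only [Matrix.mul_assoc]

lemma gainK_eq : S.gainK P = -(S.R⁻¹ * (S.Bᵀ * (P * S.saddleA P))) := by
  rw [gainK, ← inv_mul_eq_mul_saddleA hP hΦ]; simp only [Matrix.mul_assoc]

lemma gainW_eq : S.gainW P = S.lam⁻¹ • (S.Xiᵀ * (P * S.saddleA P)) := by
  rw [gainW, ← inv_mul_eq_mul_saddleA hP hΦ]

lemma saddleA_eq : S.saddleA P = S.A + S.B * S.gainK P + S.Xi * S.gainW P := by
  have h := saddleA_add hP hΦ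
  rw [gainK_eq hP hΦ, gainW_eq hP hΦ]
  calc S.saddleA P = S.A - S.Phi * P * S.saddleA P := by rw [← h]; abel
    _ = _ := by
      rw [Phi]
      simp only [Matrix.sub_mul, Matrix.smul_mul, Matrix.mul_neg, Matrix.mul_smul,
        Matrix.mul_assoc]
      abel

/-- With `f` the next state at the saddle point, the gains satisfy the stationarity conditions `R u
= -Bᵀ P f` and `lam w = Ξᵀ P f`. These cancel every term linear in `d` or `v`. -/
lemma stepCost_saddle (hR : S.R.PosDef) (hlam : S.lam ≠ 0) (x : Fin n → ℝ) (d : Fin m → ℝ)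
    (v : Fin k → ℝ) :
    S.stepCost P x (S.gainK P *ᵥ x + d) (S.gainW P *ᵥ x + v) =
      x ⬝ᵥ (S.riccatiMap P *ᵥ x) + d ⬝ᵥ (S.R *ᵥ d) - S.lam * (v ⬝ᵥ v)
        + (S.B *ᵥ d + S.Xi *ᵥ v) ⬝ᵥ (P *ᵥ (S.B *ᵥ d + S.Xi *ᵥ v)) := by
  set f := S.saddleA P *ᵥ x with hf
  set u := S.gainK P *ᵥ x with hu
  set w := S.gainW P *ᵥ x with hw
  have hPs := hP.transpose_eq_self
  have hfe : f = S.A *ᵥ x + S.B *ᵥ u + S.Xi *ᵥ w := by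
    rw [hf, saddleA_eq hP hΦ]
    simp only [Matrix.add_mulVec, ← Matrix.mulVec_mulVec]
    rfl
  have hRu : S.R *ᵥ u = -(S.Bᵀ *ᵥ (P *ᵥ f)) := by
    rw [hu, gainK_eq hP hΦ, Matrix.neg_mulVec, Matrix.mulVec_neg, Matrix.mulVec_mulVec,
      ← Matrix.mul_assoc, Matrix.mul_nonsing_inv _ ((Matrix.isUnit_iff_isUnit_det _).1 hR.isUnit),
      Matrix.one_mul]
    simp only [← Matrix.mulVec_mulVec]
    rfl
  have hlw : S.lam • w = S.Xiᵀ *ᵥ (P *ᵥ f) := by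
    rw [hw, gainW_eq hP hΦ, Matrix.smul_mulVec, smul_smul, mul_inv_cancel₀ hlam, one_smul]
    simp only [← Matrix.mulVec_mulVec]
    rfl
  have hg : x ⬝ᵥ (S.riccatiMap P *ᵥ x) = x ⬝ᵥ (S.Q *ᵥ x) + (S.A *ᵥ x) ⬝ᵥ (P *ᵥ f) := by
    rw [riccatiMap_eq hP hΦ, Matrix.add_mulVec, dotProduct_add, ← Matrix.mulVec_mulVec,
      dotProduct_transpose_mulVec_swap, ← Matrix.mulVec_mulVec]
  have hn : S.next x (u + d) (w + v) = f + (S.B *ᵥ d + S.Xi *ᵥ v) := by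
    rw [hfe, next]; simp only [Matrix.mulVec_add]; abel
  have e1 : ∀ z, z ⬝ᵥ (S.R *ᵥ u) = -((S.B *ᵥ z) ⬝ᵥ (P *ᵥ f)) := fun z => by
    rw [hRu, dotProduct_neg, dotProduct_transpose_mulVec_swap]
  have e2 : ∀ z, S.lam * (z ⬝ᵥ w) = (S.Xi *ᵥ z) ⬝ᵥ (P *ᵥ f) := fun z => by
    rw [← smul_eq_mul, ← dotProduct_smul, hlw, dotProduct_transpose_mulVec_swap]
  have hRs : S.Rᵀ = S.R := hR.posSemidef.transpose_eq_self
  have e3 : S.A *ᵥ x = f - S.B *ᵥ u - S.Xi *ᵥ w := by rw [hfe]; abel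
  rw [hg, stepCost, hn, stageCost, e3]
  generalize hz : S.B *ᵥ d + S.Xi *ᵥ v = z
  have e4 : z ⬝ᵥ (P *ᵥ f) = (S.B *ᵥ d) ⬝ᵥ (P *ᵥ f) + (S.Xi *ᵥ v) ⬝ᵥ (P *ᵥ f) := by
    rw [← hz, add_dotProduct]
  simp only [Matrix.mulVec_add, add_dotProduct, dotProduct_add, sub_dotProduct, mul_add]
  rw [dotProduct_mulVec_comm_of_isSymm hRs u d, dotProduct_mulVec_comm_of_isSymm hPs f z,
    dotProduct_comm w v]
  linarith [e1 u, e1 d, e2 w, e2 v]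

/-- Substituting `A = F + Φ P F` into `Aᵀ P F` displays the Riccati map as a sum of positive
semidefinite terms. -/
lemma riccatiMap_eq_conj : S.riccatiMap P = S.Q + (S.saddleA P)ᵀ * P * S.saddleA P
    + (P * S.saddleA P)ᵀ * S.Phi * (P * S.saddleA P) := by
  have h := congrArg Matrix.transpose (saddleA_add hP hΦ)
  rw [Matrix.transpose_add, Matrix.transpose_mul, Matrix.transpose_mul, hP.transpose_eq_self,
    hΦ.transpose_eq_self] at h
  rw [riccatiMap_eq hP hΦ, ← h, Matrix.transpose_mul, hP.transpose_eq_self]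
  simp only [Matrix.add_mul, Matrix.mul_assoc, add_assoc]

lemma riccatiMap_posSemidef (hQ : S.Q.PosSemidef) : (S.riccatiMap P).PosSemidef := by
  rw [riccatiMap_eq_conj hP hΦ]
  have h1 := hP.conjTranspose_mul_mul_same (S.saddleA P)
  have h2 := hΦ.conjTranspose_mul_mul_same (P * S.saddleA P)
  rw [Matrix.conjTranspose_eq_transpose_of_trivial] at h1 h2
  exact (hQ.add h1).add h2

/-- Against the opponent's saddle point gain the controller cannot do better than the value. -/
lemma riccatiMap_add_le_stepCost (hR : S.R.PosDef) (hlam : S.lam ≠ 0) (x : Fin n → ℝ)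
    (u : Fin m → ℝ) :
    x ⬝ᵥ (S.riccatiMap P *ᵥ x) + (u - S.gainK P *ᵥ x) ⬝ᵥ (S.R *ᵥ (u - S.gainK P *ᵥ x)) ≤
      S.stepCost P x u (S.gainW P *ᵥ x) := by
  have h := stepCost_saddle hP hΦ hR hlam x (u - S.gainK P *ᵥ x) 0
  rw [add_sub_cancel, add_zero] at h
  rw [h]
  have := hP.quad_nonneg (S.B *ᵥ (u - S.gainK P *ᵥ x))
  simp only [dotProduct_zero, mul_zero, sub_zero, Matrix.mulVec_zero, add_zero]
  linarith

/-- Against the controller's saddle point gain the opponent cannot do better than the value. -/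
lemma stepCost_gainK_le (hR : S.R.PosDef) (hlam : S.lam ≠ 0)
    (hpen : ∀ v : Fin k → ℝ, (S.Xi *ᵥ v) ⬝ᵥ (P *ᵥ (S.Xi *ᵥ v)) ≤ S.lam * (v ⬝ᵥ v))
    (x : Fin n → ℝ) (w : Fin k → ℝ) :
    S.stepCost P x (S.gainK P *ᵥ x) w ≤ x ⬝ᵥ (S.riccatiMap P *ᵥ x) := by
  have h := stepCost_saddle hP hΦ hR hlam x 0 (w - S.gainW P *ᵥ x)
  rw [add_sub_cancel, add_zero] at h
  rw [h]
  have := hpen (w - S.gainW P *ᵥ x)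
  simp only [dotProduct_zero, Matrix.mulVec_zero, zero_add, add_zero]
  linarith

end
end MinimaxLQ

/-! ### Square roots, complex eigenvectors and Lyapunov stability -/

lemma posSemidef_cfcSqrt {n : ℕ} (Q : Matrix (Fin n) (Fin n) ℝ) : (CFC.sqrt Q).PosSemidef :=
  Matrix.nonneg_iff_posSemidef.1 (CFC.sqrt_nonneg Q)

lemma cfcSqrt_mul_self {n : ℕ} {Q : Matrix (Fin n) (Fin n) ℝ} (hQ : Q.PosSemidef) :
    CFC.sqrt Q * CFC.sqrt Q = Q :=
  CFC.sqrt_mul_sqrt_self Q (Matrix.nonneg_iff_posSemidef.2 hQ)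

lemma quad_eq_cfcSqrt {n : ℕ} {Q : Matrix (Fin n) (Fin n) ℝ} (hQ : Q.PosSemidef)
    (x : Fin n → ℝ) : x ⬝ᵥ (Q *ᵥ x) = (CFC.sqrt Q *ᵥ x) ⬝ᵥ (CFC.sqrt Q *ᵥ x) := by
  rw [← dotProduct_transpose_mulVec_swap, (posSemidef_cfcSqrt Q).transpose_eq_self,
    Matrix.mulVec_mulVec, cfcSqrt_mul_self hQ]

lemma re_map_mulVec {p q : Type*} [Fintype q] (M : Matrix p q ℝ) (v : q → ℂ) :
    (fun i => ((M.map (algebraMap ℝ ℂ) *ᵥ v) i).re) = M *ᵥ fun j => (v j).re := by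
  ext i
  simp [Matrix.mulVec, dotProduct]

lemma im_map_mulVec {p q : Type*} [Fintype q] (M : Matrix p q ℝ) (v : q → ℂ) :
    (fun i => ((M.map (algebraMap ℝ ℂ) *ᵥ v) i).im) = M *ᵥ fun j => (v j).im := by
  ext i
  simp [Matrix.mulVec, dotProduct]

/-- Multiplication by `μ` acts on the pair (real part, imaginary part) as a rotation scaled by
`‖μ‖`. This lets real quadratic inequalities be applied to complex vectors. -/
lemma quad_re_add_im {n : ℕ} (P : Matrix (Fin n) (Fin n) ℝ) (μ : ℂ) (a b : Fin n → ℝ) :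
    (μ.re • a - μ.im • b) ⬝ᵥ (P *ᵥ (μ.re • a - μ.im • b))
      + (μ.re • b + μ.im • a) ⬝ᵥ (P *ᵥ (μ.re • b + μ.im • a))
      = ‖μ‖ ^ 2 * (a ⬝ᵥ (P *ᵥ a) + b ⬝ᵥ (P *ᵥ b)) := by
  simp only [Matrix.mulVec_add, Matrix.mulVec_sub, Matrix.mulVec_smul, add_dotProduct,
    sub_dotProduct, smul_dotProduct, dotProduct_add, dotProduct_sub, dotProduct_smul, smul_eq_mul]
  rw [Complex.sq_norm, Complex.normSq_apply]
  ring

lemma re_smul_vec {n : ℕ} (μ : ℂ) (v : Fin n → ℂ) :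
    (fun i => ((μ • v) i).re) = μ.re • (fun i => (v i).re) - μ.im • fun i => (v i).im := by
  ext i; simp

lemma im_smul_vec {n : ℕ} (μ : ℂ) (v : Fin n → ℂ) :
    (fun i => ((μ • v) i).im) = μ.re • (fun i => (v i).im) + μ.im • fun i => (v i).re := by
  ext i; simp

/-- Lyapunov criterion: a closed loop whose dissipation controls an observable state weight and
the feedback input is stable. -/
theorem isStableMatrix_of_lyapunov {n m : ℕ} {A P Q : Matrix (Fin n) (Fin n) ℝ}
    {B : Matrix (Fin n) (Fin m) ℝ} {L : Matrix (Fin m) (Fin n) ℝ} {W : Matrix (Fin m) (Fin m) ℝ}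
    (hP : P.PosSemidef) (hQ : Q.PosSemidef) (hW : W.PosDef) (hobs : IsObservable A (CFC.sqrt Q))
    (h : ∀ x : Fin n → ℝ, x ⬝ᵥ (Q *ᵥ x) + (L *ᵥ x) ⬝ᵥ (W *ᵥ (L *ᵥ x))
      + ((A + B * L) *ᵥ x) ⬝ᵥ (P *ᵥ ((A + B * L) *ᵥ x)) ≤ x ⬝ᵥ (P *ᵥ x)) :
    IsStableMatrix (A + B * L) := by
  intro μ hμ
  by_contra hlt
  rw [not_lt] at hlt
  have hdet : (algebraMap ℂ (Matrix (Fin n) (Fin n) ℂ) μ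
      - (A + B * L).map (algebraMap ℝ ℂ)).det = 0 := by
    rw [spectrum.mem_iff, Matrix.isUnit_iff_isUnit_det, isUnit_iff_ne_zero, not_not] at hμ
    exact hμ
  obtain ⟨v, hv0, hv⟩ := Matrix.exists_mulVec_eq_zero_iff.2 hdet
  have hv' : (A + B * L).map (algebraMap ℝ ℂ) *ᵥ v = μ • v := by
    rw [Matrix.sub_mulVec, sub_eq_zero, Algebra.algebraMap_eq_smul_one, Matrix.smul_mulVec,
      Matrix.one_mulVec] at hv
    exact hv.symm
  set a : Fin n → ℝ := fun i => (v i).re with ha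
  set b : Fin n → ℝ := fun i => (v i).im with hb
  have hMa : (A + B * L) *ᵥ a = μ.re • a - μ.im • b := by
    rw [ha, ← re_map_mulVec, hv', re_smul_vec]
  have hMb : (A + B * L) *ᵥ b = μ.re • b + μ.im • a := by
    rw [hb, ← im_map_mulVec, hv', im_smul_vec]
  have hsum := add_le_add (h a) (h b)
  have hq := quad_re_add_im P μ a b
  rw [← hMa, ← hMb] at hq
  -- If `‖μ‖ ≥ 1`, the storage does not decrease along the eigenvector, so the nonnegative
  -- dissipation terms at `a` and `b` must all vanish.
  have h1 : a ⬝ᵥ (P *ᵥ a) + b ⬝ᵥ (P *ᵥ b) ≤ ‖μ‖ ^ 2 * (a ⬝ᵥ (P *ᵥ a) + b ⬝ᵥ (P *ᵥ b)) :=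
    le_mul_of_one_le_left (add_nonneg (hP.quad_nonneg a) (hP.quad_nonneg b))
      (one_le_pow₀ hlt)
  have qa := hQ.quad_nonneg a
  have qb := hQ.quad_nonneg b
  have la := hW.posSemidef.quad_nonneg (L *ᵥ a)
  have lb := hW.posSemidef.quad_nonneg (L *ᵥ b)
  -- Zero input cost means zero input, so the closed-loop eigenvector is an eigenvector of `A`
  -- itself, to which observability of `A` applies.
  have hL : ∀ y : Fin n → ℝ, (L *ᵥ y) ⬝ᵥ (W *ᵥ (L *ᵥ y)) = 0 → (A + B * L) *ᵥ y = A *ᵥ y := by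
    intro y hy
    have : L *ᵥ y = 0 := by
      by_contra hne
      have := hW.dotProduct_mulVec_pos hne
      simp only [star_trivial] at this
      linarith
    rw [Matrix.add_mulVec, ← Matrix.mulVec_mulVec, this, Matrix.mulVec_zero, add_zero]
  have hC : ∀ y : Fin n → ℝ, y ⬝ᵥ (Q *ᵥ y) = 0 → CFC.sqrt Q *ᵥ y = 0 := fun y hy =>
    dotProduct_self_eq_zero.1 ((quad_eq_cfcSqrt hQ y).symm.trans hy)
  have hAa : A *ᵥ a = μ.re • a - μ.im • b := by rw [← hMa, hL a (by linarith)]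
  have hAb : A *ᵥ b = μ.re • b + μ.im • a := by rw [← hMb, hL b (by linarith)]
  have hCa := hC a (by linarith)
  have hCb := hC b (by linarith)
  -- The real span of `a` and `b` is `A`-invariant and killed by `Q^{1/2}`; the induction needs all
  -- combinations because `A` mixes `a` and `b`.
  have hpow : ∀ i : ℕ, ∀ c d : ℝ, (CFC.sqrt Q * A ^ i) *ᵥ (c • a + d • b) = 0 := by
    intro i
    induction i with
    | zero => intro c d; simp [Matrix.mulVec_add, Matrix.mulVec_smul, hCa, hCb]
    | succ i ih =>
      intro c d
      have : A *ᵥ (c • a + d • b)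
          = (c * μ.re + d * μ.im) • a + (d * μ.re - c * μ.im) • b := by
        rw [Matrix.mulVec_add, Matrix.mulVec_smul, Matrix.mulVec_smul, hAa, hAb]
        module
      rw [pow_succ, ← Matrix.mul_assoc, ← Matrix.mulVec_mulVec, this]
      exact ih _ _
  have ha0 : a = 0 := hobs a fun i _ => by simpa using hpow i 1 0
  have hb0 : b = 0 := hobs b fun i _ => by simpa using hpow i 0 1
  exact hv0 (funext fun i => Complex.ext (congrFun ha0 i) (congrFun hb0 i))

/-! ### Summability along stable orbits -/

lemma summable_pow_of_spectralRadius_lt_one {E : Type*} [NormedRing E] [NormedAlgebra ℂ E]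
    [CompleteSpace E] {a : E} (h : spectralRadius ℂ a < 1) : Summable fun j : ℕ => a ^ j := by
  obtain ⟨r, hr, hr1⟩ := ENNReal.lt_iff_exists_nnreal_btwn.1 h
  have hr1' : (r : ℝ) < 1 := by exact_mod_cast hr1
  -- Gelfand's formula: eventually `‖a ^ j‖ ≤ r ^ j` with `r < 1`.
  have hev := (spectrum.pow_nnnorm_pow_one_div_tendsto_nhds_spectralRadius a).eventually_lt_const hr
  refine Summable.of_norm_bounded_eventually_nat
    (summable_geometric_of_lt_one r.coe_nonneg hr1') ?_
  filter_upwards [hev, eventually_gt_atTop 0] with j hj hj0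
  have hj' : (0 : ℝ) < j := by exact_mod_cast hj0
  have := ENNReal.rpow_le_rpow hj.le hj'.le
  rw [← ENNReal.rpow_mul, one_div_mul_cancel hj'.ne', ENNReal.rpow_one, ENNReal.rpow_natCast] at this
  exact_mod_cast this

lemma IsStableMatrix.summable_map_pow {n : ℕ} {M : Matrix (Fin n) (Fin n) ℝ}
    (hM : IsStableMatrix M) : Summable fun j : ℕ => (M.map (algebraMap ℝ ℂ)) ^ j := by
  -- The `0 × 0` matrices form a trivial ring with empty spectrum, which the spectral radius bound
  -- excludes.
  rcases n with _ | n
  · exact summable_zero.congr fun j => Subsingleton.elim _ _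
  · apply summable_pow_of_spectralRadius_lt_one
    have := spectrum.spectralRadius_lt_of_forall_lt (M.map (algebraMap ℝ ℂ)) (r := 1)
      fun μ hμ => by simpa [← NNReal.coe_lt_coe] using hM μ hμ
    simpa using this

lemma IsStableMatrix.summable_pow_mulVec {n : ℕ} {M : Matrix (Fin n) (Fin n) ℝ}
    (hM : IsStableMatrix M) (x : Fin n → ℝ) (a : Fin n) :
    Summable fun j : ℕ => (M ^ j *ᵥ x) a := by
  have h1 : Summable fun j : ℕ => ((M.map (algebraMap ℝ ℂ)) ^ j *ᵥ fun i => (x i : ℂ)) a := by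
    have hc : Continuous fun N : Matrix (Fin n) (Fin n) ℂ => (N *ᵥ fun i => (x i : ℂ)) a := by
      fun_prop
    exact hM.summable_map_pow.map
      ({ toFun := fun N => (N *ᵥ fun i => (x i : ℂ)) a, map_zero' := by simp,
         map_add' := fun N N' => by simp [Matrix.add_mulVec] } :
        Matrix (Fin n) (Fin n) ℂ →+ ℂ) hc
  refine (Complex.reCLM.summable h1).congr fun j => ?_
  rw [← Matrix.map_pow]
  simpa using congrFun (re_map_mulVec (M ^ j) fun i => (x i : ℂ)) a

lemma IsStableMatrix.summable_quad {n : ℕ} {M : Matrix (Fin n) (Fin n) ℝ}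
    (hM : IsStableMatrix M) (W : Matrix (Fin n) (Fin n) ℝ) (x : Fin n → ℝ) :
    Summable fun j : ℕ => (M ^ j *ᵥ x) ⬝ᵥ (W *ᵥ (M ^ j *ᵥ x)) := by
  have h : ∀ a b, Summable fun j : ℕ => (M ^ j *ᵥ x) a * (M ^ j *ᵥ x) b := fun a b =>
    (summable_mul_of_summable_norm (hM.summable_pow_mulVec x a).norm
      (hM.summable_pow_mulVec x b).norm).comp_injective
        (i := fun j : ℕ => (j, j)) fun _ _ h => (Prod.ext_iff.1 h).1
  have hq : ∀ y : Fin n → ℝ, y ⬝ᵥ (W *ᵥ y) = ∑ a, ∑ b, W a b * (y a * y b) := fun y => by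
    simp only [dotProduct, Matrix.mulVec, Finset.mul_sum]
    exact Finset.sum_congr rfl fun a _ => Finset.sum_congr rfl fun b _ => by ring
  simp only [hq]
  exact summable_sum fun a _ => summable_sum fun b _ => (h a b).mul_left (W a b)

/-! ### Polarization: matrix limits from limits of quadratic forms -/

lemma apply_eq_quad {n : ℕ} {P : Matrix (Fin n) (Fin n) ℝ} (hP : Pᵀ = P) (i j : Fin n) :
    P i j = ((Pi.single i 1 + Pi.single j 1) ⬝ᵥ (P *ᵥ (Pi.single i 1 + Pi.single j 1))
      - Pi.single i 1 ⬝ᵥ (P *ᵥ Pi.single i 1) - Pi.single j 1 ⬝ᵥ (P *ᵥ Pi.single j 1)) / 2 := by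
  have h : P j i = P i j := congrFun (congrFun hP i) j
  simp [Matrix.mulVec_add, h]
  ring

/-- A sequence of symmetric matrices whose quadratic forms converge pointwise converges. -/
lemma exists_tendsto_of_quad {n : ℕ} {P : ℕ → Matrix (Fin n) (Fin n) ℝ} (hP : ∀ s, (P s)ᵀ = P s)
    (h : ∀ x : Fin n → ℝ, ∃ l, Tendsto (fun s => x ⬝ᵥ (P s *ᵥ x)) atTop (𝓝 l)) :
    ∃ L, Tendsto P atTop (𝓝 L) := by
  choose l hl using h
  refine ⟨fun i j => (l (Pi.single i 1 + Pi.single j 1) - l (Pi.single i 1) - l (Pi.single j 1)) / 2,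
    tendsto_pi_nhds.2 fun i => tendsto_pi_nhds.2 fun j => ?_⟩
  exact (((hl _).sub (hl _)).sub (hl _)).div_const 2 |>.congr fun s => (apply_eq_quad (hP s) i j).symm

lemma tendsto_of_quad {n : ℕ} {P : ℕ → Matrix (Fin n) (Fin n) ℝ} {L : Matrix (Fin n) (Fin n) ℝ}
    (hP : ∀ s, (P s)ᵀ = P s) (hL : Lᵀ = L)
    (h : ∀ x : Fin n → ℝ, Tendsto (fun s => x ⬝ᵥ (P s *ᵥ x)) atTop (𝓝 (x ⬝ᵥ (L *ᵥ x)))) :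
    Tendsto P atTop (𝓝 L) := by
  refine tendsto_pi_nhds.2 fun i => tendsto_pi_nhds.2 fun j => ?_
  rw [apply_eq_quad hL]
  exact (((h _).sub (h _)).sub (h _)).div_const 2 |>.congr fun s => (apply_eq_quad (hP s) i j).symm

lemma tendsto_quad {n : ℕ} {P : ℕ → Matrix (Fin n) (Fin n) ℝ} {L : Matrix (Fin n) (Fin n) ℝ}
    (h : Tendsto P atTop (𝓝 L)) (x : Fin n → ℝ) :
    Tendsto (fun s => x ⬝ᵥ (P s *ᵥ x)) atTop (𝓝 (x ⬝ᵥ (L *ᵥ x))) := by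
  have hc : Continuous fun N : Matrix (Fin n) (Fin n) ℝ => x ⬝ᵥ (N *ᵥ x) := by fun_prop
  exact (hc.tendsto L).comp h

lemma posSemidef_of_tendsto {n : ℕ} {P : ℕ → Matrix (Fin n) (Fin n) ℝ}
    {L : Matrix (Fin n) (Fin n) ℝ} (h : Tendsto P atTop (𝓝 L)) (hP : ∀ s, (P s).PosSemidef) :
    L.PosSemidef := by
  have hc : Continuous fun N : Matrix (Fin n) (Fin n) ℝ => Nᵀ := by fun_prop
  refine posSemidef_of_quad_nonneg (tendsto_nhds_unique
    (((hc.tendsto L).comp h).congr fun s => (hP s).transpose_eq_self) h) fun x => ?_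
  exact ge_of_tendsto' (tendsto_quad h x) fun s => (hP s).quad_nonneg x

/-! ### Convergence of the Riccati iteration -/

namespace MinimaxLQ

variable {n m k N : ℕ} (S : MinimaxLQ n m k N)

/-- The linear quadratic problem without disturbance that has the same Riccati map. -/
def lqr : MinimaxLQ n n 0 0 where
  A := S.A
  B := CFC.sqrt S.Phi
  Xi := 0
  Q := S.Q
  Qf := S.Qf
  R := 1
  lam := 1
  what := 0

variable {S}

lemma lqr_Phi (hΦ : S.Phi.PosSemidef) : S.lqr.Phi = S.Phi := by
  conv_lhs => rw [Phi]
  simp [lqr, (posSemidef_cfcSqrt S.Phi).transpose_eq_self, cfcSqrt_mul_self hΦ]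

lemma lqr_riccatiMap (hΦ : S.Phi.PosSemidef) : S.lqr.riccatiMap = S.riccatiMap := by
  funext P
  rw [riccatiMap, lqr_Phi hΦ]
  rfl

lemma iterate_riccatiMap_posSemidef (hΦ : S.Phi.PosSemidef) (hQ : S.Q.PosSemidef)
    {P : Matrix (Fin n) (Fin n) ℝ} (hP : P.PosSemidef) (s : ℕ) :
    (S.riccatiMap^[s] P).PosSemidef := by
  induction s with
  | zero => exact hP
  | succ s ih =>
    rw [Function.iterate_succ_apply']
    exact riccatiMap_posSemidef ih hΦ hQ

lemma riccati_eq_iterate (s : ℕ) : S.riccati s = S.riccatiMap^[s] S.Qf := by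
  induction s with
  | zero => rfl
  | succ s ih => rw [Function.iterate_succ_apply', ← ih]; rfl

lemma riccati_posSemidef (hΦ : S.Phi.PosSemidef) (hQ : S.Q.PosSemidef) (hQf : S.Qf.PosSemidef)
    (s : ℕ) : (S.riccati s).PosSemidef := by
  rw [riccati_eq_iterate]
  exact iterate_riccatiMap_posSemidef hΦ hQ hQf s

lemma continuousAt_inv_one_add {P Φ : Matrix (Fin n) (Fin n) ℝ} (h : IsUnit (1 + P * Φ)) :
    ContinuousAt (fun P : Matrix (Fin n) (Fin n) ℝ => (1 + P * Φ)⁻¹) P := by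
  have hd : (1 + P * Φ).det ≠ 0 := ((Matrix.isUnit_iff_isUnit_det _).1 h).ne_zero
  simp only [Matrix.inv_def, Ring.inverse_eq_inv']
  have h1 : Continuous fun P : Matrix (Fin n) (Fin n) ℝ => (1 + P * Φ).det := by fun_prop
  have h2 : Continuous fun P : Matrix (Fin n) (Fin n) ℝ => (1 + P * Φ).adjugate := by fun_prop
  exact (h1.continuousAt.inv₀ hd).smul h2.continuousAt

lemma continuousAt_riccatiMap (hΦ : S.Phi.PosSemidef) {P : Matrix (Fin n) (Fin n) ℝ}
    (hP : P.PosSemidef) : ContinuousAt S.riccatiMap P := by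
  have h := continuousAt_inv_one_add (isUnit_one_add_mul_of_posSemidef hP hΦ)
  unfold riccatiMap
  exact continuousAt_const.add (((continuousAt_const.mul h).mul continuousAt_id).mul continuousAt_const)

lemma continuousAt_gainK_mulVec (hΦ : S.Phi.PosSemidef) {P : Matrix (Fin n) (Fin n) ℝ}
    (hP : P.PosSemidef) (x : Fin n → ℝ) : ContinuousAt (fun P => S.gainK P *ᵥ x) P := by
  have h := continuousAt_inv_one_add (isUnit_one_add_mul_of_posSemidef hP hΦ)
  have h2 : ContinuousAt (fun P => (1 + P * S.Phi)⁻¹ * P * S.A) P :=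
    (h.mul continuousAt_id).mul continuousAt_const
  have hc : Continuous fun M : Matrix (Fin n) (Fin n) ℝ => (-(S.R⁻¹ * S.Bᵀ * M)) *ᵥ x := by fun_prop
  have := hc.continuousAt.comp h2
  unfold gainK
  simpa only [Function.comp_def, Matrix.mul_assoc] using this

section Undisturbed

variable {T : MinimaxLQ n m 0 N}

/-- The quadratic stage weight under the feedback `u = L x`. -/
def feedbackWeight (T : MinimaxLQ n m k N) (L : Matrix (Fin m) (Fin n) ℝ) :
    Matrix (Fin n) (Fin n) ℝ :=
  T.Q + Lᵀ * (T.R * L)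

lemma quad_feedbackWeight (T : MinimaxLQ n m k N) (L : Matrix (Fin m) (Fin n) ℝ)
    (x : Fin n → ℝ) :
    x ⬝ᵥ (T.feedbackWeight L *ᵥ x) = x ⬝ᵥ (T.Q *ᵥ x) + (L *ᵥ x) ⬝ᵥ (T.R *ᵥ (L *ᵥ x)) := by
  rw [feedbackWeight, Matrix.add_mulVec, dotProduct_add, ← Matrix.mulVec_mulVec,
    dotProduct_transpose_mulVec_swap, ← Matrix.mulVec_mulVec]

lemma stepCost_feedback (P : Matrix (Fin n) (Fin n) ℝ) (L : Matrix (Fin m) (Fin n) ℝ)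
    (x : Fin n → ℝ) (w : Fin 0 → ℝ) :
    T.stepCost P x (L *ᵥ x) w = x ⬝ᵥ (T.feedbackWeight L *ᵥ x)
      + ((T.A + T.B * L) *ᵥ x) ⬝ᵥ (P *ᵥ ((T.A + T.B * L) *ᵥ x)) := by
  rw [Subsingleton.elim w 0, quad_feedbackWeight]
  simp [stepCost, stageCost, next, Matrix.add_mulVec, Matrix.mulVec_mulVec]

variable {P P' : Matrix (Fin n) (Fin n) ℝ}

/-- The Riccati value is the optimal one-stage cost, and any feedback `L` is a candidate. Equality
holds at `L = gainK P`. -/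
lemma riccatiMap_le_feedback (hP : P.PosSemidef) (hΦ : T.Phi.PosSemidef) (hR : T.R.PosDef)
    (hlam : T.lam ≠ 0) (L : Matrix (Fin m) (Fin n) ℝ) (x : Fin n → ℝ) :
    x ⬝ᵥ (T.riccatiMap P *ᵥ x) ≤ x ⬝ᵥ (T.feedbackWeight L *ᵥ x)
      + ((T.A + T.B * L) *ᵥ x) ⬝ᵥ (P *ᵥ ((T.A + T.B * L) *ᵥ x)) := by
  rw [← stepCost_feedback P L x (T.gainW P *ᵥ x)]
  have h := riccatiMap_add_le_stepCost hP hΦ hR hlam x (L *ᵥ x)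
  have := hR.posSemidef.quad_nonneg (L *ᵥ x - T.gainK P *ᵥ x)
  linarith

lemma riccatiMap_eq_feedback (hP : P.PosSemidef) (hΦ : T.Phi.PosSemidef) (hR : T.R.PosDef)
    (hlam : T.lam ≠ 0) (x : Fin n → ℝ) :
    x ⬝ᵥ (T.riccatiMap P *ᵥ x) = x ⬝ᵥ (T.feedbackWeight (T.gainK P) *ᵥ x)
      + ((T.A + T.B * T.gainK P) *ᵥ x) ⬝ᵥ (P *ᵥ ((T.A + T.B * T.gainK P) *ᵥ x)) := by
  rw [← stepCost_feedback P _ x (T.gainW P *ᵥ x)]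
  simpa using (stepCost_saddle hP hΦ hR hlam x 0 0).symm

/-- The optimal gain for `P'` is a suboptimal feedback for the smaller weight `P`. -/
lemma riccatiMap_mono (hP : P.PosSemidef) (hP' : P'.PosSemidef) (hΦ : T.Phi.PosSemidef)
    (hR : T.R.PosDef) (hlam : T.lam ≠ 0)
    (h : ∀ x : Fin n → ℝ, x ⬝ᵥ (P *ᵥ x) ≤ x ⬝ᵥ (P' *ᵥ x)) (x : Fin n → ℝ) :
    x ⬝ᵥ (T.riccatiMap P *ᵥ x) ≤ x ⬝ᵥ (T.riccatiMap P' *ᵥ x) := by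
  rw [riccatiMap_eq_feedback hP' hΦ hR hlam]
  exact (riccatiMap_le_feedback hP hΦ hR hlam _ x).trans (add_le_add_right (h _) _)

lemma iterate_riccatiMap_mono (hP : P.PosSemidef) (hP' : P'.PosSemidef) (hΦ : T.Phi.PosSemidef)
    (hQ : T.Q.PosSemidef) (hR : T.R.PosDef) (hlam : T.lam ≠ 0)
    (h : ∀ x : Fin n → ℝ, x ⬝ᵥ (P *ᵥ x) ≤ x ⬝ᵥ (P' *ᵥ x)) (s : ℕ) (x : Fin n → ℝ) :
    x ⬝ᵥ (T.riccatiMap^[s] P *ᵥ x) ≤ x ⬝ᵥ (T.riccatiMap^[s] P' *ᵥ x) := by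
  induction s generalizing x with
  | zero => exact h x
  | succ s ih =>
    rw [Function.iterate_succ_apply', Function.iterate_succ_apply']
    exact riccatiMap_mono (iterate_riccatiMap_posSemidef hΦ hQ hP s)
      (iterate_riccatiMap_posSemidef hΦ hQ hP' s) hΦ hR hlam ih x

lemma iterate_riccatiMap_le_feedback (hP : P.PosSemidef) (hΦ : T.Phi.PosSemidef)
    (hQ : T.Q.PosSemidef) (hR : T.R.PosDef) (hlam : T.lam ≠ 0)
    (L : Matrix (Fin m) (Fin n) ℝ) (s : ℕ) (x : Fin n → ℝ) :
    x ⬝ᵥ (T.riccatiMap^[s] P *ᵥ x) ≤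
      ∑ i ∈ Finset.range s, ((T.A + T.B * L) ^ i *ᵥ x) ⬝ᵥ
          (T.feedbackWeight L *ᵥ ((T.A + T.B * L) ^ i *ᵥ x))
        + ((T.A + T.B * L) ^ s *ᵥ x) ⬝ᵥ (P *ᵥ ((T.A + T.B * L) ^ s *ᵥ x)) := by
  induction s generalizing x with
  | zero => simp
  | succ s ih =>
    rw [Function.iterate_succ_apply']
    refine (riccatiMap_le_feedback (iterate_riccatiMap_posSemidef hΦ hQ hP s) hΦ hR hlam L
      x).trans ?_
    have := ih ((T.A + T.B * L) *ᵥ x)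
    simp only [Matrix.mulVec_mulVec, ← pow_succ] at this
    rw [Finset.sum_range_succ']
    simp only [pow_zero, Matrix.one_mulVec, Matrix.mulVec_mulVec] at this ⊢
    linarith

lemma eq_feedback_of_fixedPoint (hP : P.PosSemidef) (hΦ : T.Phi.PosSemidef)
    (hR : T.R.PosDef) (hlam : T.lam ≠ 0) (hfix : T.riccatiMap P = P) (s : ℕ) (x : Fin n → ℝ) :
    x ⬝ᵥ (P *ᵥ x) =
      ∑ i ∈ Finset.range s, ((T.A + T.B * T.gainK P) ^ i *ᵥ x) ⬝ᵥ
          (T.feedbackWeight (T.gainK P) *ᵥ ((T.A + T.B * T.gainK P) ^ i *ᵥ x))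
        + ((T.A + T.B * T.gainK P) ^ s *ᵥ x) ⬝ᵥ
          (P *ᵥ ((T.A + T.B * T.gainK P) ^ s *ᵥ x)) := by
  induction s generalizing x with
  | zero => simp
  | succ s ih =>
    have h := riccatiMap_eq_feedback hP hΦ hR hlam x
    rw [hfix] at h
    rw [h]
    have := ih ((T.A + T.B * T.gainK P) *ᵥ x)
    simp only [Matrix.mulVec_mulVec, ← pow_succ] at this
    rw [Finset.sum_range_succ']
    simp only [pow_zero, Matrix.one_mulVec, Matrix.mulVec_mulVec] at this ⊢
    linarith

lemma feedbackWeight_posSemidef (hQ : T.Q.PosSemidef) (hR : T.R.PosDef)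
    (L : Matrix (Fin m) (Fin n) ℝ) : (T.feedbackWeight L).PosSemidef := by
  have := hR.posSemidef.conjTranspose_mul_mul_same L
  rw [Matrix.conjTranspose_eq_transpose_of_trivial, Matrix.mul_assoc] at this
  exact hQ.add this

/-- Value iteration from zero is monotone and, under stabilizability, bounded. -/
lemma exists_tendsto_iterate_riccatiMap_zero (hΦ : T.Phi.PosSemidef) (hQ : T.Q.PosSemidef)
    (hR : T.R.PosDef) (hlam : T.lam ≠ 0) (hstab : IsStabilizable T.A T.B) :
    ∃ P : Matrix (Fin n) (Fin n) ℝ, Tendsto (fun s => T.riccatiMap^[s] 0) atTop (𝓝 P) ∧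
      P.PosSemidef ∧ T.riccatiMap P = P := by
  have h0 : (0 : Matrix (Fin n) (Fin n) ℝ).PosSemidef := Matrix.PosSemidef.zero
  have hpsd := iterate_riccatiMap_posSemidef hΦ hQ h0
  obtain ⟨L, hL⟩ := hstab
  obtain ⟨P, hP⟩ : ∃ P, Tendsto (fun s => T.riccatiMap^[s] 0) atTop (𝓝 P) := by
    refine exists_tendsto_of_quad (fun s => (hpsd s).transpose_eq_self) fun x => ?_
    refine ⟨_, tendsto_atTop_ciSup (monotone_nat_of_le_succ fun s => ?_)
      -- The bound is the infinite-horizon cost of the stabilizing feedback `L`, finite since the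
      -- closed loop is stable.
      ⟨∑' i, ((T.A + T.B * L) ^ i *ᵥ x) ⬝ᵥ
          (T.feedbackWeight L *ᵥ ((T.A + T.B * L) ^ i *ᵥ x)), ?_⟩⟩
    -- One more step starts the same iteration from `riccatiMap 0 ⪰ 0`, so monotonicity of the
    -- iterates applies.
    · rw [Function.iterate_succ_apply]
      exact iterate_riccatiMap_mono h0 (riccatiMap_posSemidef h0 hΦ hQ) hΦ hQ hR hlam
        (fun y => by simpa using (riccatiMap_posSemidef h0 hΦ hQ).quad_nonneg y) s x
    · rintro _ ⟨s, rfl⟩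
      refine (iterate_riccatiMap_le_feedback h0 hΦ hQ hR hlam L s x).trans ?_
      simp only [Matrix.zero_mulVec, dotProduct_zero, add_zero]
      exact (hL.summable_quad _ x).sum_le_tsum _
        fun i _ => (feedbackWeight_posSemidef hQ hR L).quad_nonneg _
  have hPpsd := posSemidef_of_tendsto hP hpsd
  refine ⟨P, hP, hPpsd, ?_⟩
  refine tendsto_nhds_unique (((continuousAt_riccatiMap hΦ hPpsd).tendsto.comp hP).congr
    fun s => ?_) ((tendsto_add_atTop_iff_nat 1).2 hP)
  rw [Function.comp_apply, Function.iterate_succ_apply']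

/-- Value iteration of an undisturbed stabilizable and observable problem converges to the same
solution of the Riccati equation from every terminal weight. -/
lemma exists_tendsto_iterate_riccatiMap (hΦ : T.Phi.PosSemidef) (hQ : T.Q.PosSemidef)
    (hR : T.R.PosDef) (hlam : T.lam ≠ 0) (hstab : IsStabilizable T.A T.B)
    (hobs : IsObservable T.A (CFC.sqrt T.Q)) {P₀ : Matrix (Fin n) (Fin n) ℝ}
    (hP₀ : P₀.PosSemidef) :
    ∃ P : Matrix (Fin n) (Fin n) ℝ, Tendsto (fun s => T.riccatiMap^[s] P₀) atTop (𝓝 P) ∧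
      P.PosSemidef ∧ T.riccatiMap P = P := by
  obtain ⟨P, hlim, hP, hfix⟩ := exists_tendsto_iterate_riccatiMap_zero hΦ hQ hR hlam hstab
  refine ⟨P, ?_, hP, hfix⟩
  have hst : IsStableMatrix (T.A + T.B * T.gainK P) := by
    refine isStableMatrix_of_lyapunov hP hQ hR hobs fun x => ?_
    have h := riccatiMap_eq_feedback hP hΦ hR hlam x
    rw [hfix, quad_feedbackWeight] at h
    exact h.ge
  refine tendsto_of_quad
    (fun s => (iterate_riccatiMap_posSemidef hΦ hQ hP₀ s).transpose_eq_self)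
    hP.transpose_eq_self fun x => ?_
  -- Squeeze: iteration from zero bounds from below. From above, use the stationary gain for `s`
  -- steps; its cost exceeds that of the fixed point only by the terminal term with weight `P₀ - P`,
  -- which tends to zero by stability.
  have hup : Tendsto (fun s => x ⬝ᵥ (P *ᵥ x) + (((T.A + T.B * T.gainK P) ^ s *ᵥ x) ⬝ᵥ
      ((P₀ - P) *ᵥ ((T.A + T.B * T.gainK P) ^ s *ᵥ x)))) atTop (𝓝 (x ⬝ᵥ (P *ᵥ x))) := by
    simpa using tendsto_const_nhds.add (hst.summable_quad (P₀ - P) x).tendsto_atTop_zero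
  refine tendsto_of_tendsto_of_tendsto_of_le_of_le (tendsto_quad hlim x) hup
    (fun s => iterate_riccatiMap_mono Matrix.PosSemidef.zero hP₀ hΦ hQ hR hlam
      (fun y => by simpa using hP₀.quad_nonneg y) s x) fun s => ?_
  have h1 := iterate_riccatiMap_le_feedback hP₀ hΦ hQ hR hlam (T.gainK P) s x
  have h2 := eq_feedback_of_fixedPoint hP hΦ hR hlam hfix s x
  simp only [Matrix.sub_mulVec, dotProduct_sub]
  linarith

end Undisturbed

theorem exists_tendsto_riccati (hQ : S.Q.PosSemidef) (hQf : S.Qf.PosSemidef)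
    (hStab : S.StabilizabilityCondition) (hObs : S.ObservabilityCondition) :
    ∃ P : Matrix (Fin n) (Fin n) ℝ, Tendsto S.riccati atTop (𝓝 P) ∧ P.PosSemidef ∧
      S.riccatiMap P = P := by
  have hΦ := hStab.1
  have h := exists_tendsto_iterate_riccatiMap (T := S.lqr) (by rwa [lqr_Phi hΦ]) hQ
    Matrix.PosDef.one one_ne_zero hStab.2 hObs hQf
  rw [lqr_riccatiMap hΦ] at h
  simpa only [← riccati_eq_iterate] using h

end MinimaxLQ

/-! ### The finite-horizon game and its unique minimax policy -/

namespace MinimaxLQ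

variable {n m k N : ℕ} {S : MinimaxLQ n m k N}

/-- For a symmetric matrix a bound on the spectrum is a bound in the Loewner order; this non-strict
form passes to the limit. -/
lemma PenaltyCondition.quad_le (hPen : S.PenaltyCondition) (hΦ : S.Phi.PosSemidef)
    (hQ : S.Q.PosSemidef) (hQf : S.Qf.PosSemidef) (s : ℕ) (v : Fin k → ℝ) :
    (S.Xi *ᵥ v) ⬝ᵥ (S.riccati s *ᵥ (S.Xi *ᵥ v)) ≤ S.lam * (v ⬝ᵥ v) := by
  set M := S.Xiᵀ * S.riccati s * S.Xi with hM
  have hMsym : M.IsHermitian := by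
    have := (riccati_posSemidef hΦ hQ hQf s).conjTranspose_mul_mul_same S.Xi
    rw [Matrix.conjTranspose_eq_transpose_of_trivial] at this
    exact this.isHermitian
  have hle : M ≤ algebraMap ℝ (Matrix (Fin k) (Fin k) ℝ) S.lam :=
    le_algebraMap_of_spectrum_le (fun μ hμ => (hPen s μ hμ).le) (ha := hMsym)
  have := (Matrix.nonneg_iff_posSemidef.1 (sub_nonneg.2 hle)).quad_nonneg v
  rw [Algebra.algebraMap_eq_smul_one, Matrix.sub_mulVec, dotProduct_sub, Matrix.smul_mulVec,
    Matrix.one_mulVec, dotProduct_smul, hM, ← Matrix.mulVec_mulVec, ← Matrix.mulVec_mulVec,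
    dotProduct_transpose_mulVec_swap, smul_eq_mul] at this
  linarith

lemma minimaxPolicy_of_wbar_eq_zero (hw : S.wbar = 0) (P : Matrix (Fin n) (Fin n) ℝ) :
    S.minimaxPolicy P = fun x => S.gainK P *ᵥ x := by
  funext x
  simp [minimaxPolicy, offsetL, rVec, hw]

lemma gameState_succ (π : ℕ → (Fin n → ℝ) → (Fin m → ℝ)) (γ : ℕ → (Fin n → ℝ) → (Fin k → ℝ))
    (t : ℕ) (x : Fin n → ℝ) (s : ℕ) :
    S.gameState π γ t x (s + 1) = S.next (S.gameState π γ t x s)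
      (π (t + s) (S.gameState π γ t x s)) (γ (t + s) (S.gameState π γ t x s)) := rfl

/-- The controller's saddle point policy of the game with horizon `T`. -/
def saddlePolicy (S : MinimaxLQ n m k N) (T t : ℕ) (x : Fin n → ℝ) : Fin m → ℝ :=
  S.gainK (S.riccati (T - (t + 1))) *ᵥ x

/-- The opponent's saddle point policy of the game with horizon `T`. -/
def saddleDisturbance (S : MinimaxLQ n m k N) (T t : ℕ) (x : Fin n → ℝ) : Fin k → ℝ :=
  S.gainW (S.riccati (T - (t + 1))) *ᵥ x

section Game

variable (hΦ : S.Phi.PosSemidef) (hQ : S.Q.PosSemidef) (hQf : S.Qf.PosSemidef)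
  (hR : S.R.PosDef) (hlam : S.lam ≠ 0)
include hΦ hQ hQf hR hlam

lemma gameCost_saddlePolicy_le (hPen : S.PenaltyCondition) (T t : ℕ) (x : Fin n → ℝ)
    (γ : ℕ → (Fin n → ℝ) → (Fin k → ℝ)) :
    S.gameCost T t x (S.saddlePolicy T) γ ≤ x ⬝ᵥ (S.riccati (T - t) *ᵥ x) := by
  set X := S.gameState (S.saddlePolicy T) γ t x with hX
  -- Dynamic programming: cost paid so far plus value of the state reached never exceeds the initial
  -- value. Stage `t + r` is played with terminal weight `riccati (T - (t + r + 1))`.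
  have key : ∀ r ≤ T - t, ∑ s ∈ Finset.range r,
      S.stageCost (X s) (S.saddlePolicy T (t + s) (X s)) (γ (t + s) (X s))
        + X r ⬝ᵥ (S.riccati (T - t - r) *ᵥ X r) ≤ x ⬝ᵥ (S.riccati (T - t) *ᵥ x) := by
    intro r
    induction r with
    | zero => intro _; simp [hX, gameState]
    | succ r ih =>
      intro hr
      have h := stepCost_gainK_le (riccati_posSemidef hΦ hQ hQf (T - (t + r + 1))) hΦ hR hlam
        (hPen.quad_le hΦ hQ hQf _) (X r) (γ (t + r) (X r))
      rw [stepCost, show S.riccatiMap (S.riccati (T - (t + r + 1))) = S.riccati (T - t - r) by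
        rw [show T - t - r = T - (t + r + 1) + 1 by omega]; rfl] at h
      rw [Finset.sum_range_succ, show T - t - (r + 1) = T - (t + r + 1) by omega]
      have h' := ih (by omega)
      rw [hX, gameState_succ, ← hX]
      simp only [saddlePolicy] at h' ⊢
      linarith
  have := key (T - t) le_rfl
  rw [Nat.sub_self] at this
  exact this

lemma le_gameCost_saddleDisturbance (π : ℕ → (Fin n → ℝ) → (Fin m → ℝ)) {T t : ℕ} (ht : t < T)
    (x : Fin n → ℝ) :
    x ⬝ᵥ (S.riccati (T - t) *ᵥ x)
        + (π t x - S.saddlePolicy T t x) ⬝ᵥ (S.R *ᵥ (π t x - S.saddlePolicy T t x)) ≤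
      S.gameCost T t x π (S.saddleDisturbance T) := by
  set X := S.gameState π (S.saddleDisturbance T) t x with hX
  set d : ℕ → ℝ := fun s => (π (t + s) (X s) - S.saddlePolicy T (t + s) (X s)) ⬝ᵥ
    (S.R *ᵥ (π (t + s) (X s) - S.saddlePolicy T (t + s) (X s))) with hd
  have key : ∀ r ≤ T - t, x ⬝ᵥ (S.riccati (T - t) *ᵥ x) + ∑ s ∈ Finset.range r, d s ≤
      ∑ s ∈ Finset.range r,
        S.stageCost (X s) (π (t + s) (X s)) (S.saddleDisturbance T (t + s) (X s))
        + X r ⬝ᵥ (S.riccati (T - t - r) *ᵥ X r) := by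
    intro r
    induction r with
    | zero => intro _; simp [hX, gameState]
    | succ r ih =>
      intro hr
      have h := riccatiMap_add_le_stepCost (riccati_posSemidef hΦ hQ hQf (T - (t + r + 1))) hΦ hR
        hlam (X r) (π (t + r) (X r))
      rw [stepCost, show S.riccatiMap (S.riccati (T - (t + r + 1))) = S.riccati (T - t - r) by
        rw [show T - t - r = T - (t + r + 1) + 1 by omega]; rfl] at h
      rw [Finset.sum_range_succ, Finset.sum_range_succ,
        show T - t - (r + 1) = T - (t + r + 1) by omega]
      have h' := ih (by omega)
      rw [hX, gameState_succ, ← hX]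
      simp only [saddlePolicy, saddleDisturbance, hd] at h h' ⊢
      linarith
  have h := key (T - t) le_rfl
  rw [Nat.sub_self] at h
  -- Only the first deviation is kept; as `t` and `x` are arbitrary, it suffices for uniqueness at
  -- every stage and state.
  refine le_trans (add_le_add_right ?_ _) h
  have : d 0 ≤ ∑ s ∈ Finset.range (T - t), d s :=
    Finset.single_le_sum (f := d) (a := 0) (fun s _ => hR.posSemidef.quad_nonneg _)
      (Finset.mem_range.2 (by omega))
  exact this

lemma isHInfPolicy_saddlePolicy (hPen : S.PenaltyCondition) (T : ℕ) :
    S.IsHInfPolicy T (S.saddlePolicy T) := by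
  refine ⟨fun t => ?_, fun t ht x π' _ => ?_⟩
  · have : Continuous (S.saddlePolicy T t) := by unfold saddlePolicy; fun_prop
    exact this.measurable
  · refine iSup_le fun γ => ?_
    refine le_trans ?_ (le_iSup (fun γ => (S.gameCost T t x π' γ : EReal))
      (S.saddleDisturbance T))
    refine EReal.coe_le_coe_iff.2
      ((gameCost_saddlePolicy_le hΦ hQ hQf hR hlam hPen T t x γ).trans
        (le_trans ?_ (le_gameCost_saddleDisturbance hΦ hQ hQf hR hlam π' ht x)))
    exact le_add_of_nonneg_right (hR.posSemidef.quad_nonneg _)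

/-- The minimax policy is unique before the horizon. -/
lemma IsHInfPolicy.eq_saddlePolicy (hPen : S.PenaltyCondition) {T : ℕ}
    {π : ℕ → (Fin n → ℝ) → (Fin m → ℝ)} (hπ : S.IsHInfPolicy T π) {t : ℕ} (ht : t < T)
    (x : Fin n → ℝ) : π t x = S.saddlePolicy T t x := by
  -- A minimax policy guarantees no more than the saddle value, in particular against the saddle
  -- disturbance; any deviation at `(t, x)` would then cost a positive amount by definiteness of
  -- `R`.
  have h1 : (S.gameCost T t x π (S.saddleDisturbance T) : EReal) ≤
      ((x ⬝ᵥ (S.riccati (T - t) *ᵥ x) : ℝ) : EReal) :=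
    (le_iSup (fun γ => (S.gameCost T t x π γ : EReal)) (S.saddleDisturbance T)).trans
      ((hπ.2 t ht x _ (isHInfPolicy_saddlePolicy hΦ hQ hQf hR hlam hPen T).1).trans
        (iSup_le fun γ => EReal.coe_le_coe_iff.2
          (gameCost_saddlePolicy_le hΦ hQ hQf hR hlam hPen T t x γ)))
  have h2 := EReal.coe_le_coe_iff.1 h1
  have h3 := le_gameCost_saddleDisturbance hΦ hQ hQf hR hlam π ht x
  by_contra hne
  have h4 := hR.dotProduct_mulVec_pos (sub_ne_zero.2 hne)
  rw [star_trivial] at h4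
  linarith

theorem isHInfController_of_tendsto (hPen : S.PenaltyCondition) (hw : S.wbar = 0)
    {P : Matrix (Fin n) (Fin n) ℝ} (hP : P.PosSemidef) (hlim : Tendsto S.riccati atTop (𝓝 P)) :
    S.IsHInfController (S.minimaxPolicy P) := by
  refine ⟨fun T => ⟨_, isHInfPolicy_saddlePolicy hΦ hQ hQf hR hlam hPen T⟩, fun π hπ t x => ?_⟩
  rw [minimaxPolicy_of_wbar_eq_zero hw]
  have h := ((continuousAt_gainK_mulVec hΦ hP x).tendsto.comp hlim).comp
    (tendsto_sub_atTop_nat (t + 1))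
  refine h.congr' ?_
  filter_upwards [eventually_gt_atTop t] with T hT
  exact (IsHInfPolicy.eq_saddlePolicy hΦ hQ hQf hR hlam hPen (hπ T) hT x).symm

end Game

end MinimaxLQ

/-! ### The transfer function and the bounded real lemma -/

lemma map_mulVec_ofReal {p q : Type*} [Fintype q] (M : Matrix p q ℝ) (x : q → ℝ) :
    M.map (algebraMap ℝ ℂ) *ᵥ (fun i => (x i : ℂ)) = fun i => ((M *ᵥ x) i : ℂ) := by
  ext i
  simp [Matrix.mulVec, dotProduct]

lemma sum_sq_norm_eq {p : Type*} [Fintype p] (v : p → ℂ) :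
    ∑ i, ‖v i‖ ^ 2 = (fun i => (v i).re) ⬝ᵥ (fun i => (v i).re)
      + (fun i => (v i).im) ⬝ᵥ fun i => (v i).im := by
  rw [dotProduct, dotProduct, ← Finset.sum_add_distrib]
  exact Finset.sum_congr rfl fun i _ => by rw [Complex.sq_norm, Complex.normSq_apply]

lemma IsStableMatrix.isUnit_smul_one_sub {n : ℕ} {M : Matrix (Fin n) (Fin n) ℝ}
    (hM : IsStableMatrix M) {ζ : ℂ} (hζ : 1 ≤ ‖ζ‖) :
    IsUnit (ζ • (1 : Matrix (Fin n) (Fin n) ℂ) - M.map (algebraMap ℝ ℂ)) := by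
  have h : ζ ∉ spectrum ℂ (M.map (algebraMap ℝ ℂ)) := fun h => (hM ζ h).not_ge hζ
  rw [spectrum.mem_iff, not_not, Algebra.algebraMap_eq_smul_one] at h
  exact h

lemma HasSum.matrix_mulVec {ι p q : Type*} [Fintype q] (M : Matrix p q ℂ) {f : ι → q → ℂ}
    {a : q → ℂ} (h : HasSum f a) : HasSum (fun i => M *ᵥ f i) (M *ᵥ a) :=
  h.map (M.mulVecLin.toAddMonoidHom) (show Continuous fun v => M *ᵥ v by fun_prop)

/-- The `ζ`-transform of the states of a stable linear system with finitely supported input. -/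
lemma IsStableMatrix.hasSum_state {n k : ℕ} {M : Matrix (Fin n) (Fin n) ℝ}
    (hM : IsStableMatrix M) (Ξ : Matrix (Fin n) (Fin k) ℝ) {x : ℕ → Fin n → ℝ}
    {w : ℕ → Fin k → ℝ} (hx0 : x 0 = 0) (hx : ∀ t, x (t + 1) = M *ᵥ x t + Ξ *ᵥ w t) {τ : ℕ}
    (hw : ∀ t, τ ≤ t → w t = 0) {ζ : ℂ} (hζ : 1 ≤ ‖ζ‖) :
    HasSum (fun (t : ℕ) (i : Fin n) => (ζ⁻¹) ^ t * (x t i : ℂ))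
      ((ζ • (1 : Matrix (Fin n) (Fin n) ℂ) - M.map (algebraMap ℝ ℂ))⁻¹ *ᵥ
        (Ξ.map (algebraMap ℝ ℂ) *ᵥ
          ∑ t ∈ Finset.range τ, fun j => (ζ⁻¹) ^ t * (w t j : ℂ))) := by
  have hζ0 : ζ ≠ 0 := by rintro rfl; simp at hζ; linarith
  have htail : ∀ j, x (j + τ) = M ^ j *ᵥ x τ := by
    intro j
    induction j with
    | zero => simp
    | succ j ih =>
      rw [show j + 1 + τ = j + τ + 1 by ring, hx, hw (j + τ) (by omega), Matrix.mulVec_zero,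
        add_zero, ih, Matrix.mulVec_mulVec, ← pow_succ']
  -- After time `τ` the orbit is free and absolutely summable, and `‖ζ⁻¹‖ ≤ 1`, so the transform
  -- converges even on the unit circle.
  have hsum : Summable fun (t : ℕ) (i : Fin n) => (ζ⁻¹) ^ t * (x t i : ℂ) := by
    refine Pi.summable.2 fun i => ?_
    have h1 : Summable fun t => ‖x t i‖ := by
      refine (summable_nat_add_iff τ).1 ?_
      simp only [htail]
      exact (hM.summable_pow_mulVec (x τ) i).norm
    refine Summable.of_norm_bounded h1 fun t => ?_
    rw [norm_mul, norm_pow, norm_inv, Complex.norm_real]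
    exact mul_le_of_le_one_left (norm_nonneg _)
      (pow_le_one₀ (inv_nonneg.2 (norm_nonneg _)) (inv_le_one_of_one_le₀ hζ))
  obtain ⟨X, hX⟩ := hsum
  set W : Fin k → ℂ := ∑ t ∈ Finset.range τ, fun j => (ζ⁻¹) ^ t * (w t j : ℂ) with hWdef
  have hW : HasSum (fun (t : ℕ) (j : Fin k) => (ζ⁻¹) ^ t * (w t j : ℂ)) W :=
    hasSum_sum_of_ne_finset_zero fun t ht => by
      funext j
      simp [hw t (by simpa using ht)]
  -- The transform of the shifted state is computed twice: from the dynamics, and as `ζ X` because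
  -- `x 0 = 0`. Equating the two gives the resolvent equation for `X`.
  have h1 : HasSum (fun (t : ℕ) (i : Fin n) => (ζ⁻¹) ^ t * (x (t + 1) i : ℂ))
      (M.map (algebraMap ℝ ℂ) *ᵥ X + Ξ.map (algebraMap ℝ ℂ) *ᵥ W) := by
    refine ((hX.matrix_mulVec _).add (hW.matrix_mulVec _)).congr_fun ?_
    intro t
    have e1 : (fun i => (ζ⁻¹) ^ t * (x t i : ℂ)) = (ζ⁻¹) ^ t • fun i => (x t i : ℂ) := rfl
    have e2 : (fun i => (ζ⁻¹) ^ t * (w t i : ℂ)) = (ζ⁻¹) ^ t • fun i => (w t i : ℂ) := rfl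
    rw [e1, e2, Matrix.mulVec_smul, Matrix.mulVec_smul, map_mulVec_ofReal, map_mulVec_ofReal, hx]
    ext i
    simp [mul_add]
  have h2 : HasSum (fun (t : ℕ) (i : Fin n) => (ζ⁻¹) ^ t * (x (t + 1) i : ℂ)) (ζ • X) := by
    have h3 := (hasSum_nat_add_iff' 1).2 hX
    have h4 : (∑ t ∈ Finset.range 1, fun i => (ζ⁻¹) ^ t * (x t i : ℂ)) = (0 : Fin n → ℂ) := by
      ext i; simp [hx0]
    rw [h4, sub_zero] at h3
    refine (h3.const_smul ζ).congr_fun fun t => ?_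
    ext i
    simp only [Pi.smul_apply, smul_eq_mul, pow_succ]
    field_simp
  have h5 := h1.unique h2
  have h6 : (ζ • (1 : Matrix (Fin n) (Fin n) ℂ) - M.map (algebraMap ℝ ℂ)) *ᵥ X
      = Ξ.map (algebraMap ℝ ℂ) *ᵥ W := by
    rw [Matrix.sub_mulVec, Matrix.smul_mulVec, Matrix.one_mulVec, ← h5]
    abel
  rw [← h6, Matrix.mulVec_mulVec, Matrix.nonsing_inv_mul _
    ((Matrix.isUnit_iff_isUnit_det _).1 (hM.isUnit_smul_one_sub hζ)), Matrix.one_mulVec]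
  exact hX

namespace MinimaxLQ

variable {n m k N : ℕ} {S : MinimaxLQ n m k N}

theorem isTransferFunction_transfer {K : Matrix (Fin m) (Fin n) ℝ}
    (hst : IsStableMatrix (S.A + S.B * K)) :
    S.IsTransferFunction (fun x => K *ᵥ x) (S.transfer K) := by
  intro w τ hw ζ hζ
  set x := S.closedLoopState (fun x => K *ᵥ x) w with hx
  have h := (hst.hasSum_state S.Xi (x := x) rfl (fun t => by
    rw [hx, closedLoopState, Matrix.add_mulVec, Matrix.mulVec_mulVec]) hw hζ).matrix_mulVec
      ((Matrix.fromRows (CFC.sqrt S.Q) (CFC.sqrt S.R * K)).map (algebraMap ℝ ℂ))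
  rw [transfer, ← Matrix.mulVec_mulVec, ← Matrix.mulVec_mulVec]
  refine h.congr_fun fun t => ?_
  have e1 : (fun i => (ζ⁻¹) ^ t * (x t i : ℂ)) = (ζ⁻¹) ^ t • fun i => (x t i : ℂ) := rfl
  rw [e1, Matrix.mulVec_smul, map_mulVec_ofReal, Matrix.fromRows_mulVec, ← Matrix.mulVec_mulVec]
  rfl

lemma stageCost_feedback (hQ : S.Q.PosSemidef) (hR : S.R.PosSemidef)
    (K : Matrix (Fin m) (Fin n) ℝ) (x : Fin n → ℝ) (w : Fin k → ℝ) :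
    S.stageCost x (K *ᵥ x) w =
      (Matrix.fromRows (CFC.sqrt S.Q) (CFC.sqrt S.R * K) *ᵥ x) ⬝ᵥ
        (Matrix.fromRows (CFC.sqrt S.Q) (CFC.sqrt S.R * K) *ᵥ x) - S.lam * (w ⬝ᵥ w) := by
  rw [stageCost, quad_eq_cfcSqrt hQ, quad_eq_cfcSqrt hR, Matrix.fromRows_mulVec,
    sumElim_dotProduct_sumElim, Matrix.mulVec_mulVec]

/-- Bounded real lemma: a storage function for the supply rate `lam ‖w‖² - ‖z‖²` bounds the
`H∞` norm of the closed loop. -/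
theorem hInfNorm_transfer_le (hQ : S.Q.PosSemidef) (hR : S.R.PosSemidef) (hlam : 0 ≤ S.lam)
    {K : Matrix (Fin m) (Fin n) ℝ} (hst : IsStableMatrix (S.A + S.B * K))
    {P : Matrix (Fin n) (Fin n) ℝ}
    (hdis : ∀ x w, S.stepCost P x (K *ᵥ x) w ≤ x ⬝ᵥ (P *ᵥ x)) :
    hInfNorm (S.transfer K) ≤ ENNReal.ofReal (Real.sqrt S.lam) := by
  refine iSup_le fun θ => ENNReal.ofReal_le_ofReal ?_
  set ζ := Complex.exp (θ * Complex.I) with hζ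
  have hζ1 : ‖ζ‖ = 1 := Complex.norm_exp_ofReal_mul_I θ
  rw [sigmaMax, Matrix.l2_opNorm_def]
  refine ContinuousLinearMap.opNorm_le_bound _ (Real.sqrt_nonneg _) fun w => ?_
  refine abs_le_of_sq_le_sq' ?_ (by positivity) |>.2
  rw [mul_pow, Real.sq_sqrt hlam, EuclideanSpace.norm_sq_eq, EuclideanSpace.norm_sq_eq]
  set C := Matrix.fromRows (CFC.sqrt S.Q) (CFC.sqrt S.R * K) with hC
  set x : Fin n → ℂ := (ζ • (1 : Matrix (Fin n) (Fin n) ℂ)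
    - (S.A + S.B * K).map (algebraMap ℝ ℂ))⁻¹ *ᵥ (S.Xi.map (algebraMap ℝ ℂ) *ᵥ w.ofLp) with hx
  have hz : S.transfer K ζ *ᵥ w.ofLp = C.map (algebraMap ℝ ℂ) *ᵥ x := by
    rw [transfer, hx, Matrix.mulVec_mulVec, Matrix.mulVec_mulVec]
  have hdyn : ζ • x = (S.A + S.B * K).map (algebraMap ℝ ℂ) *ᵥ x
      + S.Xi.map (algebraMap ℝ ℂ) *ᵥ w.ofLp := by
    have : (ζ • (1 : Matrix (Fin n) (Fin n) ℂ) - (S.A + S.B * K).map (algebraMap ℝ ℂ)) *ᵥ x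
        = S.Xi.map (algebraMap ℝ ℂ) *ᵥ w.ofLp := by
      rw [hx, Matrix.mulVec_mulVec, Matrix.mul_nonsing_inv _
        ((Matrix.isUnit_iff_isUnit_det _).1 (hst.isUnit_smul_one_sub hζ1.ge)), Matrix.one_mulVec]
    rw [← this, Matrix.sub_mulVec, Matrix.smul_mulVec, Matrix.one_mulVec]
    abel
  change ∑ i, ‖(S.transfer K ζ *ᵥ w.ofLp) i‖ ^ 2 ≤ S.lam * ∑ i, ‖w.ofLp i‖ ^ 2
  rw [hz, sum_sq_norm_eq, sum_sq_norm_eq, re_map_mulVec, im_map_mulVec]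
  set a : Fin n → ℝ := fun i => (x i).re with ha
  set b : Fin n → ℝ := fun i => (x i).im with hb
  set c : Fin k → ℝ := fun i => (w.ofLp i).re with hc
  set d : Fin k → ℝ := fun i => (w.ofLp i).im with hd
  -- The real and imaginary parts of `ζ x = (A + B K) x + Ξ w` are two real one-step transitions.
  -- Since `‖ζ‖ = 1`, the total storage is unchanged, so adding the two dissipation inequalities
  -- leaves `‖z‖² ≤ lam ‖w‖²`.
  have hna : S.next a (K *ᵥ a) c = ζ.re • a - ζ.im • b := by
    rw [ha, hb, ← re_smul_vec, hdyn]
    rw [next, Matrix.mulVec_mulVec, ← Matrix.add_mulVec, ← re_map_mulVec, hc, ← re_map_mulVec]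
    rfl
  have hnb : S.next b (K *ᵥ b) d = ζ.re • b + ζ.im • a := by
    rw [ha, hb, ← im_smul_vec, hdyn]
    rw [next, Matrix.mulVec_mulVec, ← Matrix.add_mulVec, ← im_map_mulVec, hd, ← im_map_mulVec]
    rfl
  have h1 := hdis a c
  have h2 := hdis b d
  rw [stepCost, stageCost_feedback hQ hR, hna] at h1
  rw [stepCost, stageCost_feedback hQ hR, hnb] at h2
  have h3 := quad_re_add_im P ζ a b
  rw [hζ1, one_pow, one_mul] at h3
  linarith

end MinimaxLQ

end

theorem mainTheorem12 {n m k N : ℕ} (S : MinimaxLQ n m k N)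
    (hS : S.Standing)
    (hPen : S.PenaltyCondition)
    (hStab : S.StabilizabilityCondition)
    (hObs : S.ObservabilityCondition)
    (hw : S.wbar = 0) :
    ∃ Pss : Matrix (Fin n) (Fin n) ℝ,
      Tendsto S.riccati atTop (𝓝 Pss) ∧
      Pss.PosSemidef ∧ S.riccatiMap Pss = Pss ∧
      S.IsHInfController (S.minimaxPolicy Pss) ∧
      IsStableMatrix (S.A + S.B * S.gainK Pss) ∧
      S.IsTransferFunction (S.minimaxPolicy Pss) (S.transfer (S.gainK Pss)) ∧
      hInfNorm (S.transfer (S.gainK Pss)) ≤ ENNReal.ofReal (Real.sqrt S.lam) := by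
  obtain ⟨-, hQ, hQf, hR, hlam⟩ := hS
  have hΦ := hStab.1
  obtain ⟨P, hlim, hP, hfix⟩ := MinimaxLQ.exists_tendsto_riccati hQ hQf hStab hObs
  have hpen : ∀ v : Fin k → ℝ, (S.Xi *ᵥ v) ⬝ᵥ (P *ᵥ (S.Xi *ᵥ v)) ≤ S.lam * (v ⬝ᵥ v) := fun v =>
    le_of_tendsto' (tendsto_quad hlim _) fun s => hPen.quad_le hΦ hQ hQf s v
  have hdis : ∀ x w, S.stepCost P x (S.gainK P *ᵥ x) w ≤ x ⬝ᵥ (P *ᵥ x) := fun x w => by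
    simpa only [hfix] using MinimaxLQ.stepCost_gainK_le hP hΦ hR hlam.ne' hpen x w
  have hst : IsStableMatrix (S.A + S.B * S.gainK P) := by
    -- The dissipation inequality at `w = 0` is the required Lyapunov inequality.
    refine isStableMatrix_of_lyapunov hP hQ hR hObs fun x => ?_
    simpa [MinimaxLQ.stepCost, MinimaxLQ.stageCost, MinimaxLQ.next, Matrix.add_mulVec,
      Matrix.mulVec_mulVec] using hdis x 0
  refine ⟨P, hlim, hP, hfix,
    MinimaxLQ.isHInfController_of_tendsto hΦ hQ hQf hR hlam.ne' hPen hw hP hlim, hst, ?_,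
    MinimaxLQ.hInfNorm_transfer_le hQ hR.posSemidef hlam.le hst hdis⟩
  rw [MinimaxLQ.minimaxPolicy_of_wbar_eq_zero hw]
  exact MinimaxLQ.isTransferFunction_transfer hst
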